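/- Let $X_1,X_2,\dots$ be independent, non-negative, square integrable random variables with $\mathbb{E}X_i=1$ for all $i\ge 1$, and let $N$ be a positive integer-valued random variable with $\mathbb{E}N<\infty$ that is independent of the sequence $(X_i)_{i\ge1}$. Let $\mu=\mathbb{E}\sum_{i=1}^N X_i$ and $W=\mu^{-1}\sum_{i=1}^N X_i$. A non-negative random variable $X$ with finite mean is called NBUE (respectively NWUE) if $\mathbb{E}[X-s\mid X>s]\le \mathbb{E}X$ (respectively $\ge \mathbb{E}X$) for all real $s>0$ with $\mathbb{P}[X>s]>0$. A non-negative integer-valued random variable with finite mean is called discrete NBUE (respectively discrete NWUE) if the same inequality holds for all $s=1,2,\dots$ with $\mathbb{P}[X>s]>0$. Suppose that each $X_i$ is NBUE or NWUE (which of the two may depend on $i$), and that $N$ is discrete NBUE or discrete NWUE. Then $\sum_{i=1}^N X_i$ is integrable and $$d_{\mathrm W}\bigl(\mathscr{L}(W),\mathrm{Exp}(1)\bigr)\le 2\mu^{-1}\sup_{i\ge1}\Bigl|\tfrac12\mathbb{E}X_i^2-1\Bigr|+2\,\Bigl|\frac{\mathbb{E}N^2}{2\mu^2}+\frac1{2\mu}-1\Bigr|,$$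 where $d_{\mathrm W}(P,Q)=\sup_h|\int h\,dP-\int h\,dQ|$, the supremum being over all $h:\mathbb{R}\to\mathbb{R}$ with Lipschitz constant at most $1$, $\mathscr{L}(W)$ is the law of $W$, and $\mathrm{Exp}(1)$ is the exponential distribution with mean $1$. The right-hand side is read in $[0,\infty]$: it is $+\infty$ if $\mathbb{E}N^2=\infty$ or $\sup_i\mathbb{E}X_i^2=\infty$. -/

import Mathlib

open MeasureTheory ProbabilityTheory
open scoped ENNReal

noncomputable section

/-- The distance `d_F(P, Q) = sup_{f ∈ F} |∫ f dP - ∫ f dQ|` with respect to a class `F` of test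
functions, as an extended nonnegative real. It is meant for measures `P`, `Q` that integrate every
`f ∈ F`. -/
def testDist (F : Set (ℝ → ℝ)) (P Q : Measure ℝ) : ℝ≥0∞ :=
  ⨆ f ∈ F, ENNReal.ofReal |∫ x, f x ∂P - ∫ x, f x ∂Q|

/-- The Lipschitz functions `h : ℝ → ℝ` with `‖h'‖ ≤ 1`, i.e. with Lipschitz constant `1`. -/
def wassersteinTestFunctions : Set (ℝ → ℝ) := {h | LipschitzWith 1 h}

/-- The Wasserstein distance. -/
def wassersteinDist (P Q : Measure ℝ) : ℝ≥0∞ := testDist wassersteinTestFunctions P Q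

/-- A nonnegative random variable `X` with finite mean is NBUE if `E[X - s | X > s] ≤ E[X]` for all
`s > 0` for which the conditional expectation is defined, i.e. `P[X > s] > 0`. -/
structure IsNBUE {Ω : Type*} [MeasurableSpace Ω] (P : Measure Ω) (X : Ω → ℝ) : Prop where
  nonneg : ∀ᵐ ω ∂P, 0 ≤ X ω
  integrable : Integrable X P
  condMean_le : ∀ s : ℝ, 0 < s → P {ω | s < X ω} ≠ 0 →
    ∫ ω, (X ω - s) ∂(P[|{ω | s < X ω}]) ≤ ∫ ω, X ω ∂P

/-- A nonnegative random variable `X` with finite mean is NWUE if `E[X - s | X > s] ≥ E[X]` for all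
`s > 0` for which the conditional expectation is defined, i.e. `P[X > s] > 0`. -/
structure IsNWUE {Ω : Type*} [MeasurableSpace Ω] (P : Measure Ω) (X : Ω → ℝ) : Prop where
  nonneg : ∀ᵐ ω ∂P, 0 ≤ X ω
  integrable : Integrable X P
  le_condMean : ∀ s : ℝ, 0 < s → P {ω | s < X ω} ≠ 0 →
    ∫ ω, X ω ∂P ≤ ∫ ω, (X ω - s) ∂(P[|{ω | s < X ω}])

/-- A nonnegative integer-valued random variable `N` with finite mean is discrete NBUE if
`E[N - s | N > s] ≤ E[N]` for all `s = 1, 2, …` with `P[N > s] > 0`. -/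
structure IsDiscreteNBUE {Ω : Type*} [MeasurableSpace Ω] (P : Measure Ω) (N : Ω → ℕ) : Prop where
  integrable : Integrable (fun ω => (N ω : ℝ)) P
  condMean_le : ∀ s : ℕ, 1 ≤ s → P {ω | s < N ω} ≠ 0 →
    ∫ ω, ((N ω : ℝ) - s) ∂(P[|{ω | s < N ω}]) ≤ ∫ ω, (N ω : ℝ) ∂P

/-- A nonnegative integer-valued random variable `N` with finite mean is discrete NWUE if
`E[N - s | N > s] ≥ E[N]` for all `s = 1, 2, …` with `P[N > s] > 0`. -/
structure IsDiscreteNWUE {Ω : Type*} [MeasurableSpace Ω] (P : Measure Ω) (N : Ω → ℕ) : Prop where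
  integrable : Integrable (fun ω => (N ω : ℝ)) P
  le_condMean : ∀ s : ℕ, 1 ≤ s → P {ω | s < N ω} ≠ 0 →
    ∫ ω, (N ω : ℝ) ∂P ≤ ∫ ω, ((N ω : ℝ) - s) ∂(P[|{ω | s < N ω}])

/-- The random sum of the first `N` terms of the sequence `X`; `X i` is the `(i+1)`-st term. -/
def randomSum {Ω : Type*} (X : ℕ → Ω → ℝ) (N : Ω → ℕ) (ω : Ω) : ℝ :=
  ∑ i ∈ Finset.range (N ω), X i ω

end

/-! The proof is Stein's method for the exponential law. For a 1-Lipschitz `h` and `Z` standard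
exponential, `f x = E h(Z) - E h(x + Z)` solves `f' - f = h - E h(Z)` with `f 0 = 0`, and `f'` is
2-Lipschitz (`exists_stein_solution`). With `F s = m f(s/m)`, `G s = f'(s/m)`, `m = E N` and `S` the
random sum, the error is `E G(S) - E F(S)/m`, where `G` has Lipschitz constant `L = 2/m`.

Let `S_n` be the sum of the first `n` terms, `b n = E F(S_n)` and `a n = E G(S_n)`. The error splits
in two. Adding the `n`-th summand changes `b` by about `a (n+1)`, up to `L |E X_n²/2 - 1|`
(`abs_integral_stein_add_le`). Replacing `(a 1 + ... + a N)/m` by `a N` costs a multiple of a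
second-moment defect of `N` (`abs_integral_stein_index_le`).

Both bounds have the same source. Integration (or summation) by parts writes the defect as a
derivative (or increment) bounded by `L`, integrated against a kernel. The mean of the kernel is the
tail probability times the excess of the mean residual life over the mean, up to a positive factor.
Each aging hypothesis fixes its sign, so the integral of its absolute value is the absolute value of
its integral, an explicit second-moment expression (`abs_integral_mul_kernel_le`). -/

/-! ### The exponential law and its Stein equation -/

lemma expMeasure_one_eq :
    expMeasure 1 = (volume.restrict (Set.Ioi 0)).withDensity
      (fun t : ℝ => ENNReal.ofReal (Real.exp (-t))) := by
  have h1 : expMeasure 1 = volume.withDensity (exponentialPDF 1) := rfl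
  rw [h1, ← withDensity_indicator measurableSet_Ioi]
  refine withDensity_congr_ae ?_
  -- The density is positive at `0` as well, so the two expressions agree only off that null point.
  have h0 : ∀ᵐ t : ℝ, t ≠ 0 := by simp [ae_iff]
  filter_upwards [h0] with t ht
  rw [exponentialPDF_eq]
  by_cases hp : 0 < t
  · simp [hp, hp.le]
  · have : ¬ 0 ≤ t := fun h => hp (lt_of_le_of_ne h (Ne.symm ht))
    simp [hp, this]

lemma integral_expMeasure_one (φ : ℝ → ℝ) :
    ∫ t, φ t ∂(expMeasure 1) = ∫ t in Set.Ioi 0, Real.exp (-t) * φ t := by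
  rw [expMeasure_one_eq, integral_withDensity_eq_integral_toReal_smul (by fun_prop) (by simp)]
  simp [ENNReal.toReal_ofReal (Real.exp_pos _).le]

lemma integrable_expMeasure_one_iff (φ : ℝ → ℝ) :
    Integrable φ (expMeasure 1) ↔
      IntegrableOn (fun t => Real.exp (-t) * φ t) (Set.Ioi 0) := by
  rw [expMeasure_one_eq, integrable_withDensity_iff_integrable_smul' (by fun_prop) (by simp)]
  simp [ENNReal.toReal_ofReal (Real.exp_pos _).le, IntegrableOn]

lemma integrable_id_expMeasure_one : Integrable (fun t : ℝ => t) (expMeasure 1) := by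
  rw [integrable_expMeasure_one_iff]
  -- The mean is the Gamma integral at `2`.
  have := Real.GammaIntegral_convergent (s := 2) (by norm_num)
  refine this.congr_fun (fun t _ => ?_) measurableSet_Ioi
  norm_num

lemma LipschitzWith.integrable_comp_of_integrable {Ω : Type*} [MeasurableSpace Ω] {P : Measure Ω}
    [IsFiniteMeasure P] {K : NNReal} {h : ℝ → ℝ} (hh : LipschitzWith K h) {Y : Ω → ℝ}
    (hY : Integrable Y P) : Integrable (fun ω => h (Y ω)) P := by
  refine ((hY.norm.const_mul (K : ℝ)).add (integrable_const |h 0|)).mono'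
    (hh.continuous.comp_aestronglyMeasurable hY.1) (Filter.Eventually.of_forall fun ω => ?_)
  have := hh.dist_le_mul (Y ω) 0
  rw [Real.dist_eq, Real.dist_eq, sub_zero] at this
  have h2 := abs_sub_abs_le_abs_sub (h (Y ω)) (h 0)
  simp only [Real.norm_eq_abs, Pi.add_apply]
  linarith

/-- The function `x ↦ E h(x + Z)` with `Z` standard exponential. -/
noncomputable def expShift (h : ℝ → ℝ) (x : ℝ) : ℝ := ∫ t, h (x + t) ∂(expMeasure 1)

instance : IsProbabilityMeasure (expMeasure 1) := isProbabilityMeasure_expMeasure one_pos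

lemma integrable_shift_expMeasure_one {h : ℝ → ℝ} (hh : LipschitzWith 1 h) (x : ℝ) :
    Integrable (fun t => h (x + t)) (expMeasure 1) :=
  hh.integrable_comp_of_integrable ((integrable_const x).add integrable_id_expMeasure_one)

lemma lipschitzWith_expShift {h : ℝ → ℝ} (hh : LipschitzWith 1 h) :
    LipschitzWith 1 (expShift h) := by
  refine LipschitzWith.of_dist_le_mul fun x y => ?_
  rw [dist_eq_norm, expShift, expShift, ← integral_sub (integrable_shift_expMeasure_one hh x)
    (integrable_shift_expMeasure_one hh y)]
  refine (norm_integral_le_of_norm_le_const (C := dist x y)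
    (Filter.Eventually.of_forall fun t => ?_)).trans (by simp)
  have := hh.dist_le_mul (x + t) (y + t)
  simpa [dist_eq_norm] using this

/-- The substitution `u = x + t` moves `x` out of the argument of `h`, so that differentiating in
`x` needs only continuity of `h`. -/
lemma expShift_eq {h : ℝ → ℝ} (x : ℝ) :
    expShift h x = Real.exp x * ∫ u in Set.Ioi x, Real.exp (-u) * h u := by
  rw [expShift, integral_expMeasure_one, ← integral_const_mul]
  have he : MeasurableEmbedding (fun t : ℝ => x + t) := measurableEmbedding_addLeft x
  have := (measurePreserving_add_left (volume : Measure ℝ) x).setIntegral_preimage_emb he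
    (fun u => Real.exp x * (Real.exp (-u) * h u)) (Set.Ioi x)
  rw [← this]
  simp only [Set.preimage_const_add_Ioi, sub_self]
  refine integral_congr_ae (Filter.Eventually.of_forall fun t => ?_)
  simp only
  rw [← mul_assoc, ← Real.exp_add]
  congr 2
  ring

lemma hasDerivAt_expShift {h : ℝ → ℝ} (hh : LipschitzWith 1 h) (x : ℝ) :
    HasDerivAt (expShift h) (expShift h x - h x) x := by
  have hc : Continuous (fun u => Real.exp (-u) * h u) := by
    have := hh.continuous; fun_prop
  have hi : IntegrableOn (fun u => Real.exp (-u) * h u) (Set.Ioi 0) := by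
    rw [← integrable_expMeasure_one_iff]
    simpa using integrable_shift_expMeasure_one hh 0
  have key : ∀ y, ∫ u in Set.Ioi y, Real.exp (-u) * h u =
      (∫ u in Set.Ioi 0, Real.exp (-u) * h u) - ∫ u in (0 : ℝ)..y, Real.exp (-u) * h u := by
    intro y
    have h2 : IntegrableOn (fun u => Real.exp (-u) * h u) (Set.Ioi y) := by
      refine (hi.union (hc.continuousOn.integrableOn_Icc (a := y) (b := 0))).mono_set ?_
      intro u hu
      by_cases h0 : 0 < u
      · exact Or.inl h0
      · exact Or.inr ⟨le_of_lt hu, not_lt.1 h0⟩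
    rw [← intervalIntegral.integral_interval_add_Ioi hi h2]
    ring
  have hd : HasDerivAt (fun y => Real.exp y * ((∫ u in Set.Ioi 0, Real.exp (-u) * h u) -
      ∫ u in (0 : ℝ)..y, Real.exp (-u) * h u)) (Real.exp x *
      ((∫ u in Set.Ioi 0, Real.exp (-u) * h u) - ∫ u in (0 : ℝ)..x, Real.exp (-u) * h u) +
      Real.exp x * (0 - Real.exp (-x) * h x)) x := by
    refine (Real.hasDerivAt_exp x).mul ((hasDerivAt_const x _).sub ?_)
    exact intervalIntegral.integral_hasDerivAt_right (hc.intervalIntegrable _ _)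
      hc.aestronglyMeasurable.stronglyMeasurableAtFilter hc.continuousAt
  have hfun : expShift h = fun y => Real.exp y * ((∫ u in Set.Ioi 0, Real.exp (-u) * h u) -
      ∫ u in (0 : ℝ)..y, Real.exp (-u) * h u) := by
    funext y; rw [expShift_eq, key]
  convert hd using 1
  have : Real.exp x * Real.exp (-x) = 1 := by rw [← Real.exp_add]; simp
  simp only [hfun]
  linear_combination (h x) * this

/-- The solution of the Stein equation for the standard exponential distribution. -/
lemma exists_stein_solution {h : ℝ → ℝ} (hh : LipschitzWith 1 h) :
    ∃ f g : ℝ → ℝ, LipschitzWith 1 f ∧ LipschitzWith 2 g ∧ f 0 = 0 ∧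
      (∀ x, HasDerivAt f (g x) x) ∧ ∀ x, g x - f x = h x - ∫ t, h t ∂(expMeasure 1) := by
  have h0 : expShift h 0 = ∫ t, h t ∂(expMeasure 1) := by simp [expShift]
  -- The derivative of `f` is `h - expShift h`, a difference of two 1-Lipschitz functions; hence the
  -- constant 2.
  refine ⟨fun x => (∫ t, h t ∂(expMeasure 1)) - expShift h x, fun x => h x - expShift h x,
    ?_, ?_, by simp [h0], fun x => ?_, fun x => by ring⟩
  · simpa using (LipschitzWith.const (∫ t, h t ∂(expMeasure 1))).sub (lipschitzWith_expShift hh)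
  · have := hh.sub (lipschitzWith_expShift hh)
    rwa [one_add_one_eq_two] at this
  · simpa using (hasDerivAt_expShift hh x).const_sub (∫ t, h t ∂(expMeasure 1))

/-! ### Kernels whose mean has constant sign -/

/-- By Fubini only the `ω`-mean of the kernel matters. As it has one sign in `t`, its `L¹` norm is
the absolute value of its integral, and no cancellation is lost. -/
lemma abs_integral_mul_kernel_le {Ω T : Type*} [MeasurableSpace Ω] [MeasurableSpace T]
    {P : Measure Ω} {θ : Measure T} [SFinite P] [SFinite θ] {κ : Ω → T → ℝ}
    (hκ : Integrable (Function.uncurry κ) (P.prod θ)) {D : T → ℝ} (hD : Measurable D)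
    {L : ℝ} (hL : ∀ t, |D t| ≤ L)
    (hsign : (∀ᵐ t ∂θ, 0 ≤ ∫ ω, κ ω t ∂P) ∨ (∀ᵐ t ∂θ, ∫ ω, κ ω t ∂P ≤ 0)) :
    |∫ ω, ∫ t, D t * κ ω t ∂θ ∂P| ≤ L * |∫ ω, ∫ t, κ ω t ∂θ ∂P| := by
  have hDκ : Integrable (Function.uncurry fun ω t => D t * κ ω t) (P.prod θ) := by
    refine hκ.bdd_mul (c := L) (hD.comp measurable_snd).aestronglyMeasurable
      (Filter.Eventually.of_forall fun p => hL p.2)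
  rw [integral_integral_swap hDκ, integral_integral_swap hκ]
  have hk : Integrable (fun t => ∫ ω, κ ω t ∂P) θ := hκ.integral_prod_right
  have habs : ∫ t, |∫ ω, κ ω t ∂P| ∂θ = |∫ t, ∫ ω, κ ω t ∂P ∂θ| := by
    rcases hsign with h | h
    · rw [abs_of_nonneg (integral_nonneg_of_ae h)]
      exact integral_congr_ae (h.mono fun t ht => abs_of_nonneg ht)
    · rw [abs_of_nonpos (integral_nonpos_of_ae h), ← integral_neg]
      exact integral_congr_ae (h.mono fun t ht => abs_of_nonpos ht)
  rw [← habs, ← integral_const_mul L fun t => |∫ ω, κ ω t ∂P|]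
  have hin : ∀ t, ∫ ω, D t * κ ω t ∂P = D t * ∫ ω, κ ω t ∂P := fun t => integral_const_mul _ _
  simp only [hin]
  refine norm_integral_le_of_norm_le (f := fun t => D t * ∫ ω, κ ω t ∂P) (hk.abs.const_mul L)
    (Filter.Eventually.of_forall fun t => ?_)
  rw [norm_mul]
  exact mul_le_mul_of_nonneg_right (hL t) (norm_nonneg _)

/-- Clears the denominator of the conditional mean; when the event is null both sides vanish. -/
lemma integral_cond_excess {Ω : Type*} [MeasurableSpace Ω] {P : Measure Ω} [IsFiniteMeasure P]
    {Y : Ω → ℝ} (hY : Measurable Y) (s : ℝ) :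
    P.real {ω | s < Y ω} * ∫ ω, (Y ω - s) ∂(P[|{ω | s < Y ω}]) = ∫ ω, max (Y ω - s) 0 ∂P := by
  have hA : MeasurableSet {ω | s < Y ω} := measurableSet_lt measurable_const hY
  have h1 : ∫ ω, max (Y ω - s) 0 ∂P = ∫ ω in {ω | s < Y ω}, (Y ω - s) ∂P := by
    rw [← integral_indicator hA]
    congr 1
    funext ω
    by_cases h : s < Y ω
    · simp [h, h.le]
    · simp [h, not_lt.1 h]
  rw [h1, ProbabilityTheory.cond, integral_smul_measure]
  by_cases h0 : P {ω | s < Y ω} = 0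
  · rw [setIntegral_measure_zero _ h0]
    simp [Measure.real, h0]
  · rw [ENNReal.toReal_inv, smul_eq_mul, ← mul_assoc, Measure.real, mul_inv_cancel₀, one_mul]
    exact ENNReal.toReal_ne_zero.2 ⟨h0, measure_ne_top _ _⟩

/-! ### One summand: the continuous kernel -/

/-- The kernel `(x - t + c) 1(t < x)`, that is, `(x - t)⁺ + c 1(t < x)`. -/
noncomputable def excessKernel (c x t : ℝ) : ℝ := if t < x then x - t + c else 0

lemma measurable_excessKernel (c : ℝ) : Measurable (Function.uncurry (excessKernel c)) :=
  Measurable.ite (measurableSet_lt measurable_snd measurable_fst) (by fun_prop) measurable_const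

lemma integral_mul_excessKernel (c : ℝ) {x : ℝ} (hx : 0 ≤ x) (D : ℝ → ℝ) :
    ∫ t in Set.Ioi 0, D t * excessKernel c x t = ∫ t in (0 : ℝ)..x, (x - t + c) * D t := by
  have : (fun t => D t * excessKernel c x t) =
      (Set.Iio x).indicator fun t => (x - t + c) * D t := by
    funext t
    by_cases h : t < x
    · simp [excessKernel, h, mul_comm]
    · simp [excessKernel, h]
  rw [this, setIntegral_indicator measurableSet_Iio, intervalIntegral.integral_of_le hx,
    integral_Ioc_eq_integral_Ioo, Set.Ioi_inter_Iio]

lemma integral_excessKernel (c : ℝ) {x : ℝ} (hx : 0 ≤ x) :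
    ∫ t in Set.Ioi 0, excessKernel c x t = x ^ 2 / 2 + c * x := by
  have := integral_mul_excessKernel c hx (fun _ => 1)
  simp only [one_mul, mul_one] at this
  rw [this, intervalIntegral.integral_add (Continuous.intervalIntegrable (by fun_prop) _ _)
      (Continuous.intervalIntegrable (by fun_prop) _ _),
    intervalIntegral.integral_sub (Continuous.intervalIntegrable (by fun_prop) _ _)
      (Continuous.intervalIntegrable (by fun_prop) _ _)]
  simp
  ring

lemma integrableOn_excessKernel (c x : ℝ) :
    IntegrableOn (excessKernel c x) (Set.Ioi 0) := by
  have : excessKernel c x = (Set.Iio x).indicator fun t => (x - t + c) := by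
    funext t
    by_cases h : t < x <;> simp [excessKernel, h]
  rw [this, integrableOn_indicator_iff measurableSet_Iio]
  have hc : Continuous fun t : ℝ => x - t + c := by fun_prop
  refine (hc.continuousOn.integrableOn_Icc (a := 0) (b := x)).mono_set ?_
  exact fun t ht => ⟨(le_of_lt ht.2), (le_of_lt ht.1)⟩

lemma integrable_excessKernel_prod {Ω : Type*} [MeasurableSpace Ω] {P : Measure Ω}
    [IsProbabilityMeasure P] {X : Ω → ℝ} (hX : Measurable X) (hX0 : ∀ᵐ ω ∂P, 0 ≤ X ω)
    (hX2 : MemLp X 2 P) :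
    Integrable (Function.uncurry fun ω t => excessKernel (-1) (X ω) t)
      (P.prod (volume.restrict (Set.Ioi (0 : ℝ)))) := by
  have hm : ∀ c, Measurable (Function.uncurry fun ω t => excessKernel c (X ω) t) := fun c =>
    (measurable_excessKernel c).comp ((hX.comp measurable_fst).prodMk measurable_snd)
  have hpos : ∀ x t, 0 ≤ excessKernel 1 x t := by
    intro x t
    unfold excessKernel
    split_ifs with h <;> linarith
  -- The kernel with `c = 1` is nonnegative, dominates the one with `c = -1`, and has mass `x²/2 +
  -- x`, integrable by the second moment.
  refine Integrable.mono' (g := Function.uncurry fun ω t => excessKernel 1 (X ω) t) ?_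
    (hm _).aestronglyMeasurable (Filter.Eventually.of_forall fun p => ?_)
  · rw [integrable_prod_iff (hm 1).aestronglyMeasurable]
    refine ⟨Filter.Eventually.of_forall fun ω => integrableOn_excessKernel 1 (X ω), ?_⟩
    have hi : Integrable (fun ω => X ω ^ 2 / 2 + 1 * X ω) P :=
      (hX2.integrable_sq.div_const 2).add ((hX2.integrable (by norm_num)).const_mul 1)
    refine hi.congr (hX0.mono fun ω hω => ?_)
    simp only [Function.uncurry_apply_pair]
    rw [← integral_excessKernel 1 hω]
    exact integral_congr_ae (Filter.Eventually.of_forall fun t =>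
      (Real.norm_of_nonneg (hpos _ _)).symm)
  · simp only [Function.uncurry, excessKernel, Real.norm_eq_abs]
    split_ifs with h
    · rw [abs_le]; constructor <;> linarith
    · simp

/-- Integration by parts of `x - t - 1` against `G'` on `[0, x]`. `G` is only Lipschitz, so absolute
continuity replaces differentiability. -/
lemma sub_sub_eq_integral_excessKernel {F G : ℝ → ℝ} (hF : ∀ x, HasDerivAt F (G x) x)
    {L : NNReal} (hG : LipschitzWith L G) {x : ℝ} (hx : 0 ≤ x) :
    F x - F 0 - G x = (x - 1) * G 0 + ∫ t in Set.Ioi 0, deriv G t * excessKernel (-1) x t := by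
  rw [integral_mul_excessKernel _ hx]
  have hu : AbsolutelyContinuousOnInterval (fun t : ℝ => x - t + -1) 0 x := by
    have : LipschitzWith 1 (fun t : ℝ => x - t + -1) :=
      LipschitzWith.of_dist_le_mul fun a b => by
        rw [Real.dist_eq, Real.dist_eq, abs_sub_comm a b, NNReal.coe_one, one_mul]
        exact le_of_eq (congrArg abs (by ring))
    exact this.lipschitzOnWith.absolutelyContinuousOnInterval
  have := hu.integral_mul_deriv_eq_deriv_mul
    (hG.lipschitzOnWith.absolutelyContinuousOnInterval)
  rw [this]
  have hd : ∀ t : ℝ, deriv (fun t : ℝ => x - t + -1) t = -1 := by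
    intro t
    simp
  have hint : ∫ t in (0 : ℝ)..x, G t = F x - F 0 :=
    intervalIntegral.integral_eq_sub_of_hasDerivAt (fun t _ => hF t)
      (hG.continuous.intervalIntegrable _ _)
  simp only [hd, neg_one_mul, intervalIntegral.integral_neg, hint]
  ring

/-- The mean of the kernel is `E (X - t)⁺ - P(X > t)`, and mean one lets the last term be read as
`P(X > t) E X`. Its sign is therefore the aging inequality at `t`. -/
lemma integral_excessKernel_aging {Ω : Type*} [MeasurableSpace Ω] {P : Measure Ω}
    [IsProbabilityMeasure P] {X : Ω → ℝ} (hX : Measurable X) (hXi : Integrable X P)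
    (hm : ∫ ω, X ω ∂P = 1) (t : ℝ) :
    ∫ ω, excessKernel (-1) (X ω) t ∂P =
      P.real {ω | t < X ω} * (∫ ω, (X ω - t) ∂(P[|{ω | t < X ω}]) - ∫ ω, X ω ∂P) := by
  have hA : MeasurableSet {ω | t < X ω} := measurableSet_lt measurable_const hX
  rw [mul_sub, integral_cond_excess hX, hm, mul_one]
  have h1 : Integrable (fun ω => max (X ω - t) 0) P :=
    (hXi.sub (integrable_const t)).pos_part
  have h2 : P.real {ω | t < X ω} = ∫ ω, {ω | t < X ω}.indicator (fun _ => (1 : ℝ)) ω ∂P := by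
    rw [integral_indicator_const _ hA]; simp
  rw [h2, ← integral_sub h1 ((integrable_const 1).indicator hA)]
  congr 1
  funext ω
  by_cases h : t < X ω
  · simp [excessKernel, h, h.le]; ring
  · simp [excessKernel, h, not_lt.1 h]

/-- Mean one kills the boundary term `(X - 1) G 0`; what remains is `G'` against a kernel of
constant mean sign and total mass `E X²/2 - 1`. -/
lemma abs_integral_stein_summand_le {Ω : Type*} [MeasurableSpace Ω] {P : Measure Ω}
    [IsProbabilityMeasure P] {X : Ω → ℝ} (hX : Measurable X) (hX0 : ∀ᵐ ω ∂P, 0 ≤ X ω)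
    (hX2 : MemLp X 2 P) (hm : ∫ ω, X ω ∂P = 1) (haging : IsNBUE P X ∨ IsNWUE P X)
    {F G : ℝ → ℝ} (hF : ∀ x, HasDerivAt F (G x) x) {L : NNReal} (hG : LipschitzWith L G) :
    |∫ ω, (F (X ω) - F 0 - G (X ω)) ∂P| ≤ L * |1 / 2 * ∫ ω, X ω ^ 2 ∂P - 1| := by
  have hXi : Integrable X P := hX2.integrable (by norm_num)
  have hκ := integrable_excessKernel_prod hX hX0 hX2
  have hb : ∀ t, |deriv G t| ≤ L := fun t => norm_deriv_le_of_lipschitz hG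
  have h1 : ∫ ω, (F (X ω) - F 0 - G (X ω)) ∂P =
      ∫ ω, (∫ t in Set.Ioi 0, deriv G t * excessKernel (-1) (X ω) t) ∂P := by
    have hDκ : Integrable (Function.uncurry fun ω t => deriv G t * excessKernel (-1) (X ω) t)
        (P.prod (volume.restrict (Set.Ioi (0 : ℝ)))) :=
      hκ.bdd_mul (c := L) ((measurable_deriv G).comp measurable_snd).aestronglyMeasurable
        (Filter.Eventually.of_forall fun p => hb p.2)
    rw [integral_congr_ae (hX0.mono fun ω hω => sub_sub_eq_integral_excessKernel hF hG hω),
      integral_add (f := fun ω => (X ω - 1) * G 0)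
        (g := fun ω => ∫ t in Set.Ioi 0, deriv G t * excessKernel (-1) (X ω) t)
        ((hXi.sub (integrable_const 1)).mul_const _) hDκ.integral_prod_left,
      integral_mul_const, integral_sub hXi (integrable_const 1), hm]
    simp
  have h2 : ∫ ω, (∫ t in Set.Ioi 0, excessKernel (-1) (X ω) t) ∂P =
      1 / 2 * ∫ ω, X ω ^ 2 ∂P - 1 := by
    rw [integral_congr_ae (hX0.mono fun ω hω => integral_excessKernel (-1) hω),
      integral_add (hX2.integrable_sq.div_const 2) (hXi.const_mul (-1)), integral_div,
      integral_const_mul, hm]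
    ring
  rw [h1, ← h2]
  refine abs_integral_mul_kernel_le hκ (measurable_deriv G) hb ?_
  rcases haging with h | h
  · right
    filter_upwards [ae_restrict_mem measurableSet_Ioi] with t ht
    rw [integral_excessKernel_aging hX hXi hm]
    by_cases h0 : P {ω | t < X ω} = 0
    · simp [Measure.real, h0]
    · exact mul_nonpos_of_nonneg_of_nonpos measureReal_nonneg
        (sub_nonpos.2 (h.condMean_le t ht h0))
  · left
    filter_upwards [ae_restrict_mem measurableSet_Ioi] with t ht
    rw [integral_excessKernel_aging hX hXi hm]
    by_cases h0 : P {ω | t < X ω} = 0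
    · simp [Measure.real, h0]
    · exact mul_nonneg measureReal_nonneg (sub_nonneg.2 (h.le_condMean t ht h0))

/-! ### The random index: the discrete kernel -/

/-- The kernel `((n - k) / m + c) 1(k < n)`. -/
noncomputable def discreteKernel (m c : ℝ) (n k : ℕ) : ℝ :=
  if k < n then ((n : ℝ) - k) / m + c else 0

lemma discreteKernel_of_notMem (m c : ℝ) {n k : ℕ} (hk : k ∉ Finset.range n) :
    discreteKernel m c n k = 0 := by
  simp only [Finset.mem_range] at hk
  simp [discreteKernel, hk]

lemma integral_mul_discreteKernel (m c : ℝ) (n : ℕ) (D : ℕ → ℝ) :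
    ∫ k, D k * discreteKernel m c n k ∂Measure.count =
      ∑ k ∈ Finset.range n, D k * (((n : ℝ) - k) / m + c) := by
  have h0 : ∀ k ∉ Finset.range n, D k * discreteKernel m c n k = 0 := fun k hk => by
    rw [discreteKernel_of_notMem m c hk, mul_zero]
  have hi : Integrable (fun k => D k * discreteKernel m c n k) Measure.count := by
    rw [integrable_count_iff]
    exact summable_of_ne_finset_zero (s := Finset.range n) fun k hk => by rw [h0 k hk, norm_zero]
  rw [integral_countable hi, tsum_eq_sum (s := Finset.range n) fun k hk => by
    rw [h0 k hk, smul_zero]]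
  refine Finset.sum_congr rfl fun k hk => ?_
  simp [discreteKernel, Finset.mem_range.1 hk, Measure.real]

lemma integral_discreteKernel (m c : ℝ) (n : ℕ) :
    ∫ k, discreteKernel m c n k ∂Measure.count = (n : ℝ) * (n + 1) / (2 * m) + c * n := by
  have := integral_mul_discreteKernel m c n (fun _ => 1)
  simp only [one_mul] at this
  have h : ∀ j : ℕ, ∑ k ∈ Finset.range j, (k : ℝ) = j * (j - 1) / 2 := fun j => by
    induction j with
    | zero => simp
    | succ j ih => rw [Finset.sum_range_succ, ih]; push_cast; ring
  rw [this, Finset.sum_add_distrib, ← Finset.sum_div, Finset.sum_sub_distrib, h]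
  simp only [Finset.sum_const, Finset.card_range, nsmul_eq_mul]
  ring

lemma integrable_discreteKernel (m c : ℝ) (n : ℕ) :
    Integrable (discreteKernel m c n) Measure.count := by
  rw [integrable_count_iff]
  exact summable_of_ne_finset_zero (s := Finset.range n) fun k hk => by
    rw [discreteKernel_of_notMem m c hk, norm_zero]

lemma integrable_discreteKernel_prod {Ω : Type*} [MeasurableSpace Ω] {P : Measure Ω}
    [IsProbabilityMeasure P] {N : Ω → ℕ} (hN : Measurable N)
    (hN2 : MemLp (fun ω => (N ω : ℝ)) 2 P) {m : ℝ} (hm : 0 < m) :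
    Integrable (Function.uncurry fun ω k => discreteKernel m (-1) (N ω) k)
      (P.prod (Measure.count : Measure ℕ)) := by
  have hmeas : ∀ c, Measurable (Function.uncurry fun ω k => discreteKernel m c (N ω) k) :=
    fun c => (measurable_of_countable (Function.uncurry (discreteKernel m c))).comp
      ((hN.comp measurable_fst).prodMk measurable_snd)
  have hle : ∀ n k : ℕ, k < n → 0 ≤ ((n : ℝ) - k) / m := fun n k h =>
    div_nonneg (sub_nonneg.2 (by exact_mod_cast h.le)) hm.le
  have hpos : ∀ n k, 0 ≤ discreteKernel m 1 n k := by
    intro n k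
    unfold discreteKernel
    split_ifs with h
    · linarith [hle n k h]
    · exact le_rfl
  refine Integrable.mono' (g := Function.uncurry fun ω k => discreteKernel m 1 (N ω) k) ?_
    (hmeas _).aestronglyMeasurable (Filter.Eventually.of_forall fun p => ?_)
  · rw [integrable_prod_iff (hmeas 1).aestronglyMeasurable]
    refine ⟨Filter.Eventually.of_forall fun ω => integrable_discreteKernel m 1 (N ω), ?_⟩
    have hN1 : Integrable (fun ω => (N ω : ℝ)) P := hN2.integrable (by norm_num)
    have hi : Integrable (fun ω => ((N ω : ℝ) ^ 2 + N ω) / (2 * m) + 1 * N ω) P :=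
      ((hN2.integrable_sq.add hN1).div_const _).add (hN1.const_mul 1)
    refine hi.congr (Filter.Eventually.of_forall fun ω => ?_)
    simp only [Function.uncurry_apply_pair]
    rw [show (N ω : ℝ) ^ 2 + N ω = N ω * (N ω + 1) by ring, ← integral_discreteKernel m 1]
    exact integral_congr_ae (Filter.Eventually.of_forall fun t =>
      (Real.norm_of_nonneg (hpos _ _)).symm)
  · simp only [Function.uncurry, discreteKernel, Real.norm_eq_abs]
    split_ifs with h
    · have := hle _ _ h
      rw [abs_le]; constructor <;> linarith
    · simp

/-- Summation by parts, the discrete counterpart of `sub_sub_eq_integral_excessKernel`. -/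
lemma sum_succ_div_sub_eq (a : ℕ → ℝ) (m : ℝ) (n : ℕ) :
    (∑ i ∈ Finset.range n, a (i + 1)) / m - a n = ((n : ℝ) / m - 1) * a 0 +
      ∑ k ∈ Finset.range n, (a (k + 1) - a k) * (((n : ℝ) - k) / m + -1) := by
  have h1 : ∑ k ∈ Finset.range n, (a (k + 1) - a k) = a n - a 0 := Finset.sum_range_sub a n
  have h2 : ∑ k ∈ Finset.range n, (a (k + 1) - a k) * ((n : ℝ) - k) =
      (∑ i ∈ Finset.range n, a (i + 1)) - n * a 0 := by
    clear h1
    induction n with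
    | zero => simp
    | succ n ih =>
      have h1 : ∑ k ∈ Finset.range n, (a (k + 1) - a k) = a n - a 0 := Finset.sum_range_sub a n
      have : ∑ k ∈ Finset.range n, (a (k + 1) - a k) * (((n + 1 : ℕ) : ℝ) - k) =
          ∑ k ∈ Finset.range n, (a (k + 1) - a k) * ((n : ℝ) - k) +
            ∑ k ∈ Finset.range n, (a (k + 1) - a k) := by
        rw [← Finset.sum_add_distrib]
        refine Finset.sum_congr rfl fun k _ => ?_
        push_cast; ring
      rw [Finset.sum_range_succ, this, ih, h1, Finset.sum_range_succ]
      push_cast; ring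
  have h3 : ∑ k ∈ Finset.range n, (a (k + 1) - a k) * (((n : ℝ) - k) / m + -1) =
      (∑ k ∈ Finset.range n, (a (k + 1) - a k) * ((n : ℝ) - k)) / m -
        ∑ k ∈ Finset.range n, (a (k + 1) - a k) := by
    rw [Finset.sum_div, ← Finset.sum_sub_distrib]
    exact Finset.sum_congr rfl fun k _ => by ring
  rw [h3, h1, h2]
  ring

lemma integral_discreteKernel_aging {Ω : Type*} [MeasurableSpace Ω] {P : Measure Ω}
    [IsProbabilityMeasure P] {N : Ω → ℕ} (hN : Measurable N)
    (hNi : Integrable (fun ω => (N ω : ℝ)) P) (hm : 0 < ∫ ω, (N ω : ℝ) ∂P) (k : ℕ) :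
    ∫ ω, discreteKernel (∫ ω, (N ω : ℝ) ∂P) (-1) (N ω) k ∂P = P.real {ω | k < N ω} *
      (∫ ω, ((N ω : ℝ) - k) ∂(P[|{ω | k < N ω}]) - ∫ ω, (N ω : ℝ) ∂P) /
        ∫ ω, (N ω : ℝ) ∂P := by
  set m := ∫ ω, (N ω : ℝ) ∂P
  have hA : MeasurableSet {ω | k < N ω} := measurableSet_lt measurable_const hN
  have hc := integral_cond_excess (P := P) (Y := fun ω => (N ω : ℝ))
    ((measurable_of_countable _).comp hN) k
  simp only [Nat.cast_lt] at hc
  rw [mul_sub, hc, sub_div, mul_div_cancel_right₀ _ hm.ne', ← integral_div]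
  have h1 : Integrable (fun ω => max ((N ω : ℝ) - k) 0 / m) P :=
    (hNi.sub (integrable_const (k : ℝ))).pos_part.div_const m
  have h2 : P.real {ω | k < N ω} = ∫ ω, {ω | k < N ω}.indicator (fun _ => (1 : ℝ)) ω ∂P := by
    rw [integral_indicator_const _ hA]; simp
  rw [h2, ← integral_sub h1 ((integrable_const 1).indicator hA)]
  congr 1
  funext ω
  by_cases h : k < N ω
  · have : (k : ℝ) ≤ N ω := by exact_mod_cast h.le
    simp [discreteKernel, h, this]; ring
  · have : (N ω : ℝ) ≤ k := by exact_mod_cast not_lt.1 h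
    simp [discreteKernel, h, this]

lemma abs_integral_stein_index_le {Ω : Type*} [MeasurableSpace Ω] {P : Measure Ω}
    [IsProbabilityMeasure P] {N : Ω → ℕ} (hN : Measurable N) (hN0 : ∀ᵐ ω ∂P, 0 < N ω)
    (hN2 : MemLp (fun ω => (N ω : ℝ)) 2 P) {m : ℝ} (hm : m = ∫ ω, (N ω : ℝ) ∂P) (hm0 : 0 < m)
    (haging : IsDiscreteNBUE P N ∨ IsDiscreteNWUE P N) {a : ℕ → ℝ} {L : ℝ}
    (ha : ∀ k, |a (k + 1) - a k| ≤ L) :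
    |∫ ω, ((∑ i ∈ Finset.range (N ω), a (i + 1)) / m - a (N ω)) ∂P| ≤
      L * |(∫ ω, (N ω : ℝ) ^ 2 ∂P + m) / (2 * m) - m| := by
  have hNi : Integrable (fun ω => (N ω : ℝ)) P := hN2.integrable (by norm_num)
  have hκ := integrable_discreteKernel_prod hN hN2 hm0
  have hDm : Measurable fun k => a (k + 1) - a k := measurable_of_countable _
  have h1 : ∫ ω, ((∑ i ∈ Finset.range (N ω), a (i + 1)) / m - a (N ω)) ∂P =
      ∫ ω, (∫ k, (a (k + 1) - a k) * discreteKernel m (-1) (N ω) k ∂Measure.count) ∂P := by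
    have hDκ : Integrable (Function.uncurry fun ω k =>
        (a (k + 1) - a k) * discreteKernel m (-1) (N ω) k) (P.prod Measure.count) :=
      hκ.bdd_mul (c := L) (hDm.comp measurable_snd).aestronglyMeasurable
        (Filter.Eventually.of_forall fun p => ha p.2)
    have he : ∀ ω, (∑ i ∈ Finset.range (N ω), a (i + 1)) / m - a (N ω) =
        ((N ω : ℝ) / m - 1) * a 0 +
          ∫ k, (a (k + 1) - a k) * discreteKernel m (-1) (N ω) k ∂Measure.count := fun ω => by
      rw [sum_succ_div_sub_eq, integral_mul_discreteKernel]
    simp only [he]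
    rw [integral_add (f := fun ω => ((N ω : ℝ) / m - 1) * a 0)
        (g := fun ω => ∫ k, (a (k + 1) - a k) * discreteKernel m (-1) (N ω) k ∂Measure.count)
        (((hNi.div_const m).sub (integrable_const 1)).mul_const _) hDκ.integral_prod_left,
      integral_mul_const, integral_sub (hNi.div_const m) (integrable_const 1), integral_div, ← hm,
      div_self hm0.ne']
    simp
  have h2 : ∫ ω, (∫ k, discreteKernel m (-1) (N ω) k ∂Measure.count) ∂P =
      (∫ ω, (N ω : ℝ) ^ 2 ∂P + m) / (2 * m) - m := by
    have he : ∀ ω, ∫ k, discreteKernel m (-1) (N ω) k ∂Measure.count =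
        ((N ω : ℝ) ^ 2 + N ω) / (2 * m) - N ω := fun ω => by
      rw [integral_discreteKernel]; ring
    simp only [he]
    have hs : Integrable (fun ω => (N ω : ℝ) ^ 2 + N ω) P := hN2.integrable_sq.add hNi
    rw [integral_sub (hs.div_const _) hNi, integral_div,
      integral_add hN2.integrable_sq hNi, ← hm]
  rw [h1, ← h2]
  refine abs_integral_mul_kernel_le hκ hDm ha ?_
  subst hm
  -- The discrete aging condition starts at `s = 1`. At `k = 0` positivity of `N` makes the kernel
  -- `N/m - 1`, of mean zero, which is compatible with either sign.
  have hzero : ∫ ω, discreteKernel (∫ ω, (N ω : ℝ) ∂P) (-1) (N ω) 0 ∂P = 0 := by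
    have : ∀ᵐ ω ∂P, discreteKernel (∫ ω, (N ω : ℝ) ∂P) (-1) (N ω) 0 =
        (N ω : ℝ) / (∫ ω, (N ω : ℝ) ∂P) - 1 := hN0.mono fun ω hω => by
      simp [discreteKernel, hω]; ring
    rw [integral_congr_ae this, integral_sub (hNi.div_const _) (integrable_const 1), integral_div,
      div_self hm0.ne']
    simp
  rcases haging with h | h
  · right
    refine Filter.Eventually.of_forall fun k => ?_
    rcases Nat.eq_zero_or_pos k with rfl | hk
    · exact hzero.le
    rw [integral_discreteKernel_aging hN hNi hm0]
    by_cases h0 : P {ω | k < N ω} = 0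
    · simp [Measure.real, h0]
    · exact div_nonpos_of_nonpos_of_nonneg (mul_nonpos_of_nonneg_of_nonpos measureReal_nonneg
        (sub_nonpos.2 (h.condMean_le k hk h0))) hm0.le
  · left
    refine Filter.Eventually.of_forall fun k => ?_
    rcases Nat.eq_zero_or_pos k with rfl | hk
    · exact hzero.ge
    rw [integral_discreteKernel_aging hN hNi hm0]
    by_cases h0 : P {ω | k < N ω} = 0
    · simp [Measure.real, h0]
    · exact div_nonneg (mul_nonneg measureReal_nonneg (sub_nonneg.2 (h.le_condMean k hk h0))) hm0.le

lemma abs_integral_le_of_abs_le {Ω : Type*} [MeasurableSpace Ω] {P : Measure Ω} {f g : Ω → ℝ}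
    (hg : Integrable g P) (h : ∀ᵐ ω ∂P, |f ω| ≤ g ω) : |∫ ω, f ω ∂P| ≤ ∫ ω, g ω ∂P :=
  norm_integral_le_of_norm_le (f := f) hg h

/-! ### Independent random indices -/

section RandomIndex

variable {Ω E : Type*} [MeasurableSpace Ω] [MeasurableSpace E] {P : Measure Ω}
  [IsProbabilityMeasure P] {Y : Ω → E} {N : Ω → ℕ} {u : ℕ → E → ℝ}

lemma measurable_uncurry_nat_index (hu : ∀ n, Measurable (u n)) :
    Measurable fun p : E × ℕ => u p.2 p.1 :=
  measurable_from_prod_countable_left hu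

lemma integrable_random_index (hY : Measurable Y) (hN : Measurable N) (hind : IndepFun Y N P)
    (hu : ∀ n, Measurable (u n)) (hi : ∀ n, Integrable (fun ω => u n (Y ω)) P)
    (hn : Integrable (fun ω' => ∫ ω, |u (N ω') (Y ω)| ∂P) P) :
    Integrable (fun ω => u (N ω) (Y ω)) P := by
  have hm := measurable_uncurry_nat_index hu
  have h1 : Integrable (fun p : E × ℕ => u p.2 p.1) (P.map fun ω => (Y ω, N ω)) := by
    rw [hind.map_prod_eq_prod_map_map hY.aemeasurable hN.aemeasurable,
      integrable_prod_iff' hm.aestronglyMeasurable]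
    refine ⟨Filter.Eventually.of_forall fun n => ?_, ?_⟩
    · exact (integrable_map_measure (hu n).aestronglyMeasurable hY.aemeasurable).2 (hi n)
    · rw [integrable_map_measure (measurable_of_countable _).aestronglyMeasurable hN.aemeasurable]
      refine hn.congr (Filter.Eventually.of_forall fun ω' => ?_)
      simp only [Function.comp]
      rw [integral_map hY.aemeasurable (hu _).norm.aestronglyMeasurable]
      rfl
  exact (integrable_map_measure hm.aestronglyMeasurable (hY.prodMk hN).aemeasurable).1 h1

lemma integral_random_index (hY : Measurable Y) (hN : Measurable N) (hind : IndepFun Y N P)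
    (hu : ∀ n, Measurable (u n)) (hi : Integrable (fun ω => u (N ω) (Y ω)) P) :
    Integrable (fun ω' => ∫ ω, u (N ω') (Y ω) ∂P) P ∧
      ∫ ω, u (N ω) (Y ω) ∂P = ∫ ω', (∫ ω, u (N ω') (Y ω) ∂P) ∂P := by
  have hm := measurable_uncurry_nat_index hu
  have h1 : Integrable (fun p : E × ℕ => u p.2 p.1) ((P.map Y).prod (P.map N)) := by
    rw [← hind.map_prod_eq_prod_map_map hY.aemeasurable hN.aemeasurable]
    exact (integrable_map_measure hm.aestronglyMeasurable (hY.prodMk hN).aemeasurable).2 hi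
  have h2 : ∀ n, ∫ y, u n y ∂(P.map Y) = ∫ ω, u n (Y ω) ∂P := fun n =>
    integral_map hY.aemeasurable (hu n).aestronglyMeasurable
  have h3 := h1.integral_prod_right
  simp only [h2] at h3
  refine ⟨(integrable_map_measure (measurable_of_countable _).aestronglyMeasurable
    hN.aemeasurable).1 h3, ?_⟩
  have h4 : ∫ ω, u (N ω) (Y ω) ∂P = ∫ p, u p.2 p.1 ∂(P.map fun ω => (Y ω, N ω)) :=
    (integral_map (hY.prodMk hN).aemeasurable hm.aestronglyMeasurable).symm
  rw [h4, hind.map_prod_eq_prod_map_map hY.aemeasurable hN.aemeasurable, integral_prod_symm _ h1]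
  simp only [h2]
  exact integral_map hN.aemeasurable (measurable_of_countable _).aestronglyMeasurable

end RandomIndex

/-! ### Stein bounds for the random sum -/

section RandomSum

variable {Ω : Type*} [MeasurableSpace Ω] {P : Measure Ω} [IsProbabilityMeasure P]
  {X : ℕ → Ω → ℝ} {N : Ω → ℕ}

/-- Wald's identity: given `N = n` the sum has mean `n`, also in absolute value by nonnegativity. -/
lemma integrable_randomSum (hX_meas : ∀ i, Measurable (X i))
    (hX_nonneg : ∀ i, ∀ᵐ ω ∂P, 0 ≤ X i ω) (hX_int : ∀ i, Integrable (X i) P)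
    (hX_mean : ∀ i, ∫ ω, X i ω ∂P = 1) (hN_meas : Measurable N)
    (hN_int : Integrable (fun ω => (N ω : ℝ)) P)
    (hind : IndepFun (fun ω i => X i ω) N P) :
    Integrable (randomSum X N) P ∧ ∫ ω, randomSum X N ω ∂P = ∫ ω, (N ω : ℝ) ∂P := by
  have hY : Measurable (fun ω i => X i ω) := measurable_pi_iff.2 hX_meas
  have hu : ∀ n : ℕ, Measurable fun x : ℕ → ℝ => ∑ i ∈ Finset.range n, x i := fun n => by
    fun_prop
  have hsum : ∀ n : ℕ, ∫ ω, ∑ i ∈ Finset.range n, X i ω ∂P = n := fun n => by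
    rw [integral_finsetSum _ fun i _ => hX_int i]
    simp [hX_mean]
  have habs : ∀ n : ℕ, ∫ ω, |∑ i ∈ Finset.range n, X i ω| ∂P = n := fun n => by
    rw [← hsum n]
    refine integral_congr_ae ((ae_all_iff.2 hX_nonneg).mono fun ω hω => ?_)
    exact abs_of_nonneg (Finset.sum_nonneg fun i _ => hω i)
  have hi : Integrable (randomSum X N) P :=
    integrable_random_index (u := fun n (x : ℕ → ℝ) => ∑ i ∈ Finset.range n, x i) hY hN_meas hind hu
      (fun n => integrable_finsetSum _ fun i _ => hX_int i) (by simpa only [habs] using hN_int)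
  refine ⟨hi, ?_⟩
  have := (integral_random_index (u := fun n (x : ℕ → ℝ) => ∑ i ∈ Finset.range n, x i) hY hN_meas hind hu
    hi).2
  simp only [hsum] at this
  exact this

lemma measurable_randomSum (hX_meas : ∀ i, Measurable (X i)) (hN_meas : Measurable N) :
    Measurable (randomSum X N) :=
  (measurable_uncurry_nat_index (u := fun n (x : ℕ → ℝ) => ∑ i ∈ Finset.range n, x i)
    fun n => by fun_prop).comp ((measurable_pi_iff.2 hX_meas).prodMk hN_meas)

/-- Conditioning on `S = s` reduces to the single-summand bound for `F` and `G` shifted by `s`; that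
bound does not depend on `s`. -/
lemma abs_integral_stein_add_le {S Z : Ω → ℝ} (hS : Measurable S) (hSi : Integrable S P)
    (hZ : Measurable Z) (hZ0 : ∀ᵐ ω ∂P, 0 ≤ Z ω) (hZ2 : MemLp Z 2 P) (hm : ∫ ω, Z ω ∂P = 1)
    (haging : IsNBUE P Z ∨ IsNWUE P Z) (hind : IndepFun S Z P)
    {F G : ℝ → ℝ} (hF : ∀ x, HasDerivAt F (G x) x) {K L : NNReal} (hFL : LipschitzWith K F)
    (hG : LipschitzWith L G) :
    |∫ ω, (F (S ω + Z ω) - F (S ω) - G (S ω + Z ω)) ∂P| ≤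
      L * |1 / 2 * ∫ ω, Z ω ^ 2 ∂P - 1| := by
  have hZi : Integrable Z P := hZ2.integrable (by norm_num)
  have hFc := hFL.continuous
  have hGc := hG.continuous
  have hφ : Measurable fun p : ℝ × ℝ => F (p.1 + p.2) - F p.1 - G (p.1 + p.2) :=
    Continuous.measurable (by fun_prop)
  have hi : Integrable (fun ω => F (S ω + Z ω) - F (S ω) - G (S ω + Z ω)) P :=
    ((hFL.integrable_comp_of_integrable (hSi.add hZi)).sub
      (hFL.integrable_comp_of_integrable hSi)).sub (hG.integrable_comp_of_integrable (hSi.add hZi))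
  have hip : Integrable (fun p : ℝ × ℝ => F (p.1 + p.2) - F p.1 - G (p.1 + p.2))
      ((P.map S).prod (P.map Z)) := by
    rw [← hind.map_prod_eq_prod_map_map hS.aemeasurable hZ.aemeasurable]
    exact (integrable_map_measure hφ.aestronglyMeasurable (hS.prodMk hZ).aemeasurable).2 hi
  have h4 : ∫ ω, (F (S ω + Z ω) - F (S ω) - G (S ω + Z ω)) ∂P =
      ∫ p : ℝ × ℝ, (F (p.1 + p.2) - F p.1 - G (p.1 + p.2)) ∂(P.map fun ω => (S ω, Z ω)) :=
    (integral_map (hS.prodMk hZ).aemeasurable hφ.aestronglyMeasurable).symm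
  rw [h4, hind.map_prod_eq_prod_map_map hS.aemeasurable hZ.aemeasurable, integral_prod _ hip]
  have : IsProbabilityMeasure (P.map S) := Measure.isProbabilityMeasure_map hS.aemeasurable
  refine (abs_integral_le_of_abs_le (integrable_const (L * |1 / 2 * ∫ ω, Z ω ^ 2 ∂P - 1|))
    (Filter.Eventually.of_forall fun s => ?_)).trans (by simp)
  have h5 : ∫ z, (F (s + z) - F s - G (s + z)) ∂(P.map Z) =
      ∫ ω, (F (s + Z ω) - F (s + 0) - G (s + Z ω)) ∂P := by
    rw [integral_map hZ.aemeasurable (Continuous.aestronglyMeasurable (by fun_prop))]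
    simp
  simp only [h5]
  refine abs_integral_stein_summand_le (F := fun x => F (s + x)) (G := fun x => G (s + x)) hZ hZ0
    hZ2 hm haging (fun x => (hF (s + x)).comp_const_add s x) ?_
  refine LipschitzWith.of_dist_le_mul fun x y => ?_
  simpa using hG.dist_le_mul (s + x) (s + y)

/-- The constant `K` serves only integrability and does not enter the bound. -/
lemma abs_integral_stein_randomSum_le
    (hX_meas : ∀ i, Measurable (X i)) (hX_nonneg : ∀ i, ∀ᵐ ω ∂P, 0 ≤ X i ω)
    (hX_sq : ∀ i, MemLp (X i) 2 P) (hX_indep : iIndepFun X P)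
    (hX_mean : ∀ i, ∫ ω, X i ω ∂P = 1) (hX_aging : ∀ i, IsNBUE P (X i) ∨ IsNWUE P (X i))
    (hN_meas : Measurable N) (hN_pos : ∀ᵐ ω ∂P, 0 < N ω)
    (hN2 : MemLp (fun ω => (N ω : ℝ)) 2 P)
    (hN_aging : IsDiscreteNBUE P N ∨ IsDiscreteNWUE P N)
    (hind : IndepFun (fun ω i => X i ω) N P)
    {m : ℝ} (hm : m = ∫ ω, (N ω : ℝ) ∂P) (hm0 : 0 < m)
    {δ : ℝ} (hδ : ∀ i, |1 / 2 * ∫ ω, X i ω ^ 2 ∂P - 1| ≤ δ)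
    {F G : ℝ → ℝ} (hF0 : F 0 = 0) (hF : ∀ x, HasDerivAt F (G x) x) {K L : NNReal}
    (hFL : LipschitzWith K F) (hG : LipschitzWith L G) :
    |(∫ ω, F (randomSum X N ω) ∂P) / m - ∫ ω, G (randomSum X N ω) ∂P| ≤
      L * δ + L * |(∫ ω, (N ω : ℝ) ^ 2 ∂P + m) / (2 * m) - m| := by
  have hX_int : ∀ i, Integrable (X i) P := fun i => (hX_sq i).integrable (by norm_num)
  have hN_int : Integrable (fun ω => (N ω : ℝ)) P := hN2.integrable (by norm_num)
  have hS := (integrable_randomSum hX_meas hX_nonneg hX_int hX_mean hN_meas hN_int hind).1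
  have hY : Measurable (fun ω i => X i ω) := measurable_pi_iff.2 hX_meas
  have hFc := hFL.continuous
  have hGc := hG.continuous
  have hsm : ∀ n : ℕ, Measurable fun ω => ∑ i ∈ Finset.range n, X i ω := fun n => by fun_prop
  have hsi : ∀ n : ℕ, Integrable (fun ω => ∑ i ∈ Finset.range n, X i ω) P := fun n =>
    integrable_finsetSum _ fun i _ => hX_int i
  set a : ℕ → ℝ := fun n => ∫ ω, G (∑ i ∈ Finset.range n, X i ω) ∂P with ha
  set b : ℕ → ℝ := fun n => ∫ ω, F (∑ i ∈ Finset.range n, X i ω) ∂P with hb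
  obtain ⟨haN, hGa⟩ := integral_random_index
    (u := fun n (x : ℕ → ℝ) => G (∑ i ∈ Finset.range n, x i)) hY hN_meas hind
    (fun n => Continuous.measurable (by fun_prop)) (hG.integrable_comp_of_integrable hS)
  obtain ⟨hbN, hFb⟩ := integral_random_index
    (u := fun n (x : ℕ → ℝ) => F (∑ i ∈ Finset.range n, x i)) hY hN_meas hind
    (fun n => Continuous.measurable (by fun_prop)) (hFL.integrable_comp_of_integrable hS)
  change Integrable (fun ω => a (N ω)) P at haN
  change Integrable (fun ω => b (N ω)) P at hbN
  change ∫ ω, G (randomSum X N ω) ∂P = ∫ ω, a (N ω) ∂P at hGa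
  change ∫ ω, F (randomSum X N ω) ∂P = ∫ ω, b (N ω) ∂P at hFb
  have hstep : ∀ n, |b (n + 1) - b n - a (n + 1)| ≤ L * δ := by
    intro n
    have hi : IndepFun (fun ω => ∑ i ∈ Finset.range n, X i ω) (X n) P := by
      have := hX_indep.indepFun_finsetSum_of_notMem hX_meas (s := Finset.range n) (i := n)
        (by simp)
      convert this using 1
      funext ω
      simp
    have h := abs_integral_stein_add_le (hsm n) (hsi n) (hX_meas n) (hX_nonneg n) (hX_sq n)
      (hX_mean n) (hX_aging n) hi hF hFL hG
    have hF1 := hFL.integrable_comp_of_integrable ((hsi n).add (hX_int n))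
    have hF2 := hFL.integrable_comp_of_integrable (hsi n)
    have hG1 := hG.integrable_comp_of_integrable ((hsi n).add (hX_int n))
    simp only [Pi.add_apply] at hF1 hG1
    have hF12 : Integrable (fun ω => F (∑ i ∈ Finset.range n, X i ω + X n ω) -
      F (∑ i ∈ Finset.range n, X i ω)) P := hF1.sub hF2
    rw [integral_sub hF12 hG1, integral_sub hF1 hF2] at h
    simp only [ha, hb, Finset.sum_range_succ]
    exact h.trans (mul_le_mul_of_nonneg_left (hδ n) L.2)
  have hb0 : b 0 = 0 := by simp [hb, hF0]
  have hsum : ∀ n : ℕ, |b n - ∑ i ∈ Finset.range n, a (i + 1)| ≤ n * (L * δ) := by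
    intro n
    have : b n - ∑ i ∈ Finset.range n, a (i + 1) =
        ∑ i ∈ Finset.range n, (b (i + 1) - b i - a (i + 1)) := by
      rw [Finset.sum_sub_distrib, Finset.sum_range_sub, hb0, sub_zero]
    rw [this]
    refine (Finset.abs_sum_le_sum_abs _ _).trans ((Finset.sum_le_sum fun i _ => hstep i).trans ?_)
    simp
  -- One more summand moves the partial sum by `X k`, whose mean is one.
  have hainc : ∀ k, |a (k + 1) - a k| ≤ L := by
    intro k
    rw [ha, ← integral_sub (hG.integrable_comp_of_integrable (hsi (k + 1)))
      (hG.integrable_comp_of_integrable (hsi k))]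
    have h1 : ∫ ω, (L : ℝ) * X k ω ∂P = L := by rw [integral_const_mul, hX_mean, mul_one]
    refine le_trans (abs_integral_le_of_abs_le ((hX_int k).const_mul (L : ℝ))
      ((hX_nonneg k).mono fun ω hω => ?_)) h1.le
    have := hG.dist_le_mul (∑ i ∈ Finset.range (k + 1), X i ω) (∑ i ∈ Finset.range k, X i ω)
    rw [Real.dist_eq, Real.dist_eq, Finset.sum_range_succ, add_sub_cancel_left,
      abs_of_nonneg hω] at this
    rwa [Finset.sum_range_succ]
  -- Integrability of the sum of the `a (i + 1)` up to `N` comes from that of `b (N ω)` and of this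
  -- difference, dominated by a multiple of `N`.
  have hdiff : Integrable (fun ω => b (N ω) - ∑ i ∈ Finset.range (N ω), a (i + 1)) P :=
    (hN_int.mul_const (L * δ)).mono' ((measurable_of_countable
      fun n : ℕ => b n - ∑ i ∈ Finset.range n, a (i + 1)).comp hN_meas).aestronglyMeasurable
      (Filter.Eventually.of_forall fun ω => hsum (N ω))
  have hAN : Integrable (fun ω => ∑ i ∈ Finset.range (N ω), a (i + 1)) P := by
    refine (hbN.sub hdiff).congr (Filter.Eventually.of_forall fun ω => ?_)
    simp
  have e1 : |∫ ω, (b (N ω) - ∑ i ∈ Finset.range (N ω), a (i + 1)) ∂P| ≤ m * (L * δ) := by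
    rw [hm, ← integral_mul_const]
    exact abs_integral_le_of_abs_le (hN_int.mul_const (L * δ))
      (Filter.Eventually.of_forall fun ω => hsum (N ω))
  have e2 := abs_integral_stein_index_le hN_meas hN_pos hN2 hm hm0 hN_aging hainc
  have e3 : (∫ ω, F (randomSum X N ω) ∂P) / m - ∫ ω, G (randomSum X N ω) ∂P =
      (∫ ω, (b (N ω) - ∑ i ∈ Finset.range (N ω), a (i + 1)) ∂P) / m +
        ∫ ω, ((∑ i ∈ Finset.range (N ω), a (i + 1)) / m - a (N ω)) ∂P := by
    rw [hFb, hGa, integral_sub hbN hAN, integral_sub (hAN.div_const m) haN, integral_div]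
    ring
  rw [e3]
  refine (abs_add_le _ _).trans (add_le_add ?_ e2)
  rw [abs_div, abs_of_pos hm0, div_le_iff₀ hm0]
  linarith

end RandomSum

/-! ### Rescaling and conclusion -/

lemma abs_integral_sub_expMeasure_le {Ω : Type*} [MeasurableSpace Ω] {P : Measure Ω}
    [IsProbabilityMeasure P] {X : ℕ → Ω → ℝ} {N : Ω → ℕ}
    (hX_meas : ∀ i, Measurable (X i)) (hX_nonneg : ∀ i, ∀ᵐ ω ∂P, 0 ≤ X i ω)
    (hX_sq : ∀ i, MemLp (X i) 2 P) (hX_indep : iIndepFun X P)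
    (hX_mean : ∀ i, ∫ ω, X i ω ∂P = 1) (hX_aging : ∀ i, IsNBUE P (X i) ∨ IsNWUE P (X i))
    (hN_meas : Measurable N) (hN_pos : ∀ᵐ ω ∂P, 0 < N ω)
    (hN2 : MemLp (fun ω => (N ω : ℝ)) 2 P)
    (hN_aging : IsDiscreteNBUE P N ∨ IsDiscreteNWUE P N)
    (hind : IndepFun (fun ω i => X i ω) N P)
    {m : ℝ} (hm : m = ∫ ω, (N ω : ℝ) ∂P) (hm0 : 0 < m)
    {δ : ℝ} (hδ : ∀ i, |1 / 2 * ∫ ω, X i ω ^ 2 ∂P - 1| ≤ δ)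
    {h : ℝ → ℝ} (hh : LipschitzWith 1 h) :
    |∫ ω, h (m⁻¹ * randomSum X N ω) ∂P - ∫ t, h t ∂(expMeasure 1)| ≤
      2 * m⁻¹ * δ + 2 * |(∫ ω, (N ω : ℝ) ^ 2 ∂P) / (2 * m ^ 2) + 1 / (2 * m) - 1| := by
  obtain ⟨f, g, hf, hg, hf0, hfg, hst⟩ := exists_stein_solution hh
  have hX_int : ∀ i, Integrable (X i) P := fun i => (hX_sq i).integrable (by norm_num)
  have hS := ((integrable_randomSum hX_meas hX_nonneg hX_int hX_mean hN_meas
    (hN2.integrable (by norm_num)) hind).1).const_mul m⁻¹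
  have hscale : LipschitzWith (m⁻¹).toNNReal fun s : ℝ => m⁻¹ * s :=
    LipschitzWith.of_dist_le_mul fun x y => by
      rw [Real.coe_toNNReal _ (inv_nonneg.2 hm0.le), Real.dist_eq, Real.dist_eq, ← mul_sub,
        abs_mul, abs_of_pos (inv_pos.2 hm0)]
  -- The outer factor `m` cancels the `m⁻¹` of the chain rule, so the scaling appears only in the
  -- Lipschitz constant `2 m⁻¹` of `G`.
  have hF : ∀ x, HasDerivAt (fun s => m * f (m⁻¹ * s)) (g (m⁻¹ * x)) x := fun x => by
    have := ((hfg (m⁻¹ * x)).comp x ((hasDerivAt_id x).const_mul m⁻¹)).const_mul m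
    have h2 : m * (g (m⁻¹ * x) * (m⁻¹ * 1)) = g (m⁻¹ * x) := by
      rw [mul_one, mul_comm (g _), ← mul_assoc, mul_inv_cancel₀ hm0.ne', one_mul]
    rwa [h2] at this
  have hFL : LipschitzWith (m.toNNReal * (1 * (m⁻¹).toNNReal)) fun s => m * f (m⁻¹ * s) :=
    LipschitzWith.of_dist_le_mul fun x y => by
      have := (hf.comp hscale).dist_le_mul x y
      rw [NNReal.coe_mul, Real.coe_toNNReal _ hm0.le, Real.dist_eq, ← mul_sub, abs_mul,
        abs_of_pos hm0, mul_assoc]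
      exact mul_le_mul_of_nonneg_left this hm0.le
  have key := abs_integral_stein_randomSum_le hX_meas hX_nonneg hX_sq hX_indep hX_mean hX_aging
    hN_meas hN_pos hN2 hN_aging hind hm hm0 hδ (F := fun s => m * f (m⁻¹ * s))
    (G := fun s => g (m⁻¹ * s)) (by simp [hf0]) hF hFL (hg.comp hscale)
  have e1 : ∫ ω, h (m⁻¹ * randomSum X N ω) ∂P - ∫ t, h t ∂(expMeasure 1) =
      -((∫ ω, m * f (m⁻¹ * randomSum X N ω) ∂P) / m - ∫ ω, g (m⁻¹ * randomSum X N ω) ∂P) := by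
    rw [integral_const_mul, mul_div_cancel_left₀ _ hm0.ne', neg_sub,
      ← integral_sub (hg.integrable_comp_of_integrable hS) (hf.integrable_comp_of_integrable hS)]
    simp only [hst]
    rw [integral_sub (hh.integrable_comp_of_integrable hS) (integrable_const _)]
    simp
  rw [e1, abs_neg]
  refine key.trans (le_of_eq ?_)
  rw [NNReal.coe_mul, Real.coe_toNNReal _ (inv_nonneg.2 hm0.le), NNReal.coe_ofNat]
  congr 1
  -- The factor `m` taken out here cancels that `m⁻¹`, leaving the coefficient 2.
  have : (∫ ω, (N ω : ℝ) ^ 2 ∂P + m) / (2 * m) - m =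
      m * ((∫ ω, (N ω : ℝ) ^ 2 ∂P) / (2 * m ^ 2) + 1 / (2 * m) - 1) := by
    field_simp
  rw [this, abs_mul, abs_of_pos hm0]
  field_simp

lemma lintegral_natCast_sq_eq {Ω : Type*} [MeasurableSpace Ω] {P : Measure Ω} {N : Ω → ℕ}
    (hN : Measurable N) (hfin : ∫⁻ ω, (N ω : ℝ≥0∞) ^ 2 ∂P ≠ ⊤) :
    MemLp (fun ω => (N ω : ℝ)) 2 P ∧
      ((∫⁻ ω, (N ω : ℝ≥0∞) ^ 2 ∂P : ℝ≥0∞) : EReal) = ((∫ ω, (N ω : ℝ) ^ 2 ∂P : ℝ) : EReal) := by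
  have hNm : Measurable fun ω => (N ω : ℝ) := (measurable_of_countable _).comp hN
  have he : ∀ ω, (N ω : ℝ≥0∞) ^ 2 = ENNReal.ofReal ((N ω : ℝ) ^ 2) := fun ω => by
    rw [ENNReal.ofReal_pow (Nat.cast_nonneg _), ENNReal.ofReal_natCast]
  simp only [he] at hfin ⊢
  have hi : Integrable (fun ω => (N ω : ℝ) ^ 2) P := by
    refine ⟨(hNm.pow_const 2).aestronglyMeasurable, ?_⟩
    rw [hasFiniteIntegral_iff_ofReal (Filter.Eventually.of_forall fun ω => sq_nonneg _)]
    exact lt_top_iff_ne_top.2 hfin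
  refine ⟨(memLp_two_iff_integrable_sq hNm.aestronglyMeasurable).2 hi, ?_⟩
  rw [← ofReal_integral_eq_lintegral_ofReal hi (Filter.Eventually.of_forall fun ω => sq_nonneg _),
    EReal.coe_ennreal_ofReal, max_eq_left (integral_nonneg fun ω => sq_nonneg _)]

/-- The right-hand side is computed in `[0, ∞]`: neither `sup_i E X_i²` nor `E N²` is assumed to be
finite, so `E N²` is a lower Lebesgue integral and the second absolute value is that of `EReal`. -/
theorem mainTheorem8 {Ω : Type*} [MeasurableSpace Ω] (P : Measure Ω) [IsProbabilityMeasure P]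
    (X : ℕ → Ω → ℝ) (N : Ω → ℕ)
    (hX_meas : ∀ i, Measurable (X i))
    (hX_nonneg : ∀ i, ∀ᵐ ω ∂P, 0 ≤ X i ω)
    (hX_sq : ∀ i, MemLp (X i) 2 P)
    (hX_indep : iIndepFun X P)
    (hX_mean : ∀ i, ∫ ω, X i ω ∂P = 1)
    (hX_aging : ∀ i, IsNBUE P (X i) ∨ IsNWUE P (X i))
    (hN_meas : Measurable N)
    (hN_pos : ∀ᵐ ω ∂P, 0 < N ω)
    (hN_int : Integrable (fun ω => (N ω : ℝ)) P)
    (hN_aging : IsDiscreteNBUE P N ∨ IsDiscreteNWUE P N)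
    (hXN_indep : IndepFun (fun ω i => X i ω) N P)
    (μ : ℝ) (hμ : μ = ∫ ω, randomSum X N ω ∂P)
    (W : Ω → ℝ) (hW : ∀ ω, W ω = μ⁻¹ * randomSum X N ω) :
    Integrable (randomSum X N) P ∧
    wassersteinDist (P.map W) (expMeasure 1) ≤
      ENNReal.ofReal (2 * μ⁻¹) * (⨆ i, ENNReal.ofReal |1 / 2 * ∫ ω, X i ω ^ 2 ∂P - 1|)
        + 2 * EReal.abs (((∫⁻ ω, (N ω : ℝ≥0∞) ^ 2 ∂P : ℝ≥0∞) : EReal) / ((2 * μ ^ 2 : ℝ) : EReal)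
            + ((1 / (2 * μ) : ℝ) : EReal) - 1) := by
  have hX_int : ∀ i, Integrable (X i) P := fun i => (hX_sq i).integrable (by norm_num)
  obtain ⟨hS, hSN⟩ := integrable_randomSum hX_meas hX_nonneg hX_int hX_mean hN_meas hN_int
    hXN_indep
  refine ⟨hS, ?_⟩
  have hμN : μ = ∫ ω, (N ω : ℝ) ∂P := hμ.trans hSN
  have hμ0 : 0 < μ := by
    have h1 : ∫ _ω, (1 : ℝ) ∂P ≤ ∫ ω, (N ω : ℝ) ∂P :=
      integral_mono_ae (integrable_const 1) hN_int (hN_pos.mono fun ω hω => by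
        simpa using (Nat.one_le_cast (α := ℝ)).2 hω)
    rw [hμN]
    simp only [integral_const, probReal_univ, smul_eq_mul, mul_one] at h1
    linarith
  by_cases hN2 : ∫⁻ ω, (N ω : ℝ≥0∞) ^ 2 ∂P = ⊤
  · have htop : ((⊤ : ℝ≥0∞) : EReal) / ((2 * μ ^ 2 : ℝ) : EReal)
            + ((1 / (2 * μ) : ℝ) : EReal) - 1 = ⊤ := by
      rw [EReal.coe_ennreal_top, EReal.top_div_of_pos_ne_top (by exact_mod_cast by positivity)
        (EReal.coe_ne_top _), EReal.top_add_coe]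
      rfl
    rw [hN2, htop]
    simp
  by_cases hsup : (⨆ i, ENNReal.ofReal |1 / 2 * ∫ ω, X i ω ^ 2 ∂P - 1|) = ⊤
  -- Needed because `0 * ⊤ = 0` in `ℝ≥0∞`.
  · have : ENNReal.ofReal (2 * μ⁻¹) ≠ 0 := by
      rw [Ne, ENNReal.ofReal_eq_zero, not_le]
      positivity
    rw [hsup, ENNReal.mul_top this, top_add]
    exact le_top
  obtain ⟨hN2', hN2e⟩ := lintegral_natCast_sq_eq hN_meas hN2
  have hrhs : ((∫⁻ ω, (N ω : ℝ≥0∞) ^ 2 ∂P : ℝ≥0∞) : EReal) / ((2 * μ ^ 2 : ℝ) : EReal)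
            + ((1 / (2 * μ) : ℝ) : EReal) - 1 =
      (((∫ ω, (N ω : ℝ) ^ 2 ∂P) / (2 * μ ^ 2) + 1 / (2 * μ) - 1 : ℝ) : EReal) := by
    rw [hN2e, ← EReal.coe_div, ← EReal.coe_add, EReal.coe_sub, EReal.coe_one]
  rw [hrhs, EReal.abs_def, ← ENNReal.ofReal_toReal hsup, ← ENNReal.ofReal_mul (by positivity),
    ← ENNReal.ofReal_ofNat 2, ← ENNReal.ofReal_mul (by norm_num),
    ← ENNReal.ofReal_add (by positivity) (by positivity)]
  have hWe : W = fun ω => μ⁻¹ * randomSum X N ω := funext hW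
  have hWm : Measurable W := by
    rw [hWe]
    exact (measurable_randomSum hX_meas hN_meas).const_mul _
  refine iSup₂_le fun h hh => ENNReal.ofReal_le_ofReal ?_
  have hh1 : LipschitzWith 1 h := hh
  rw [integral_map hWm.aemeasurable hh1.continuous.aestronglyMeasurable, hWe]
  refine abs_integral_sub_expMeasure_le hX_meas hX_nonneg hX_sq hX_indep hX_mean hX_aging hN_meas
    hN_pos hN2' hN_aging hXN_indep hμN hμ0 (fun i => ?_) hh1
  rw [← ENNReal.ofReal_le_iff_le_toReal hsup]
  exact le_iSup (fun i => ENNReal.ofReal |1 / 2 * ∫ ω, X i ω ^ 2 ∂P - 1|) i
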